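/- Let $k$ be a commutative artinian ring and let $\Lambda$ be an Artin $k$-algebra, i.e. a unital associative $k$-algebra that is finitely generated as a $k$-module. All modules are left modules. The global dimension $\operatorname{gl.dim}\Gamma$ of a ring $\Gamma$ is the supremum of the projective dimensions of all $\Gamma$-modules. 1. For every finitely generated $\Lambda$-module $X$ there is a finitely generated $\Lambda$-module $X'$ such that the endomorphism ring $\operatorname{End}_\Lambda(X\oplus X')$ has finite global dimension. 2. In particular, $\Lambda$ has finite representation dimension, where $$\operatorname{rep.dim}\Lambda=\min\{\operatorname{gl.dim}\operatorname{End}_\Lambda(\overline X)\}$$ and $\overline X$ runs over the finitely generated $\Lambda$-modules that generate and cogenerate the category of finitely generated $\Lambda$-modules, i.e. such that every finitely generated $\Lambda$-module is a quotient of $\overline X^{\,n}$ for some $n$ and a submodule of $\overline X^{\,m}$ for some $m$. -/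

import Mathlib

universe u v w

/-- The (left) global dimension of a ring: the supremum of the projective dimensions of all left
modules. It is `⊥` exactly for the zero ring, and `⊤` when it is infinite. -/
noncomputable def globalDimension (R : Type u) [Ring R] : WithBot ℕ∞ :=
  ⨆ M : ModuleCat.{u} R, CategoryTheory.projectiveDimension M

/-- `X` generates the category of finitely generated left `R`-modules: each such module is a
quotient of a finite direct sum of copies of `X`. -/
def GeneratesFGModules (R : Type u) [Ring R] (X : Type u) [AddCommGroup X] [Module R X] : Prop :=
  ∀ (M : Type u) [AddCommGroup M] [Module R M] [Module.Finite R M],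
    ∃ (n : ℕ) (f : (Fin n → X) →ₗ[R] M), Function.Surjective f

/-- `X` cogenerates the category of finitely generated left `R`-modules: each such module embeds
into a finite direct sum of copies of `X`. -/
def CogeneratesFGModules (R : Type u) [Ring R] (X : Type u) [AddCommGroup X] [Module R X] : Prop :=
  ∀ (M : Type u) [AddCommGroup M] [Module R M] [Module.Finite R M],
    ∃ (n : ℕ) (f : M →ₗ[R] (Fin n → X)), Function.Injective f

/-- The representation dimension of `R`: the minimum of the global dimensions of the endomorphism
rings of the finitely generated left `R`-modules that generate and cogenerate the category of
finitely generated left `R`-modules (`⊤` if there is no such module). Since `WithBot ℕ∞` is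
well-ordered, the infimum of a nonempty set is attained. -/
noncomputable def representationDimension (R : Type u) [Ring R] : WithBot ℕ∞ :=
  sInf {d : WithBot ℕ∞ | ∃ (X : Type u) (_ : AddCommGroup X) (_ : Module R X),
    Module.Finite R X ∧ GeneratesFGModules R X ∧ CogeneratesFGModules R X ∧
      globalDimension (Module.End R X) = d}

/-!
The construction is Iyama's. Put `M₀ = X` and let `M_{t+1}` be the quotient of `M_t` by the
elements killed by the Jacobson radical of `End M_t`. This radical is nilpotent and `X` is
noetherian, so `M_n = 0` for some `n`; take `Y = X × M₁ × ⋯ × M_n`. For `t ≤ j` every nonzero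
element of `M_j` is detected by a map `M_j → M_t`, so a radical endomorphism of `Y` going from
`M_t` to `M_j` kills the kernel of `M_t → M_{t+1}` and factors through `M_{t+1}`. Hence the kernel
of the projective cover of a simple `End Y`-module belonging to `M_t` contains a projective
submodule, generated by a component of `M_t → M_{t+1}`, modulo which only the simple modules
belonging to `M₀, …, M_{t-1}` occur. Induction on `t` bounds all projective dimensions.

For the representation dimension, start with `X = Λ × Hom_Z(Λ, E)`, where `Z` is the center of
`Λ` and `E` is a finite `Z`-module separating the points of all `Z`-modules. Such an `E` is the
quotient of an injective module containing `T = ∏ Z/m` by a submodule maximal among those meeting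
`T` trivially: `T` is essential in `E`, hence contains the part of `E` killed by the radical of `Z`,
and `E` is finite because that radical is nilpotent.
-/

open CategoryTheory

section ProjectiveDimension

variable {R : Type u} [Ring R]

lemma hasProjectiveDimensionLE_of_projective (M : Type u) [AddCommGroup M] [Module R M]
    [Module.Projective R M] (n : ℕ) : HasProjectiveDimensionLE (ModuleCat.of R M) n :=
  have : Projective (ModuleCat.of R M) := ModuleCat.projective_of_categoryTheory_projective _
  hasProjectiveDimensionLT_of_ge _ 1 (n + 1) (by lia)

section Surjective

variable {M N : Type u} [AddCommGroup M] [Module R M] [AddCommGroup N] [Module R N] {n : ℕ}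
  {f : M →ₗ[R] N}

lemma hasProjectiveDimensionLE_of_ker_of_surjective (hf : Function.Surjective f)
    (hker : HasProjectiveDimensionLE (ModuleCat.of R (LinearMap.ker f)) n)
    (hN : HasProjectiveDimensionLE (ModuleCat.of R N) n) :
    HasProjectiveDimensionLE (ModuleCat.of R M) n :=
  (LinearMap.shortExact_shortComplexKer hf).hasProjectiveDimensionLT_X₂ _ hker hN

lemma hasProjectiveDimensionLE_succ_iff_ker [Module.Projective R M] (hf : Function.Surjective f) :
    HasProjectiveDimensionLE (ModuleCat.of R N) (n + 1) ↔
      HasProjectiveDimensionLE (ModuleCat.of R (LinearMap.ker f)) n :=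
  (LinearMap.shortExact_shortComplexKer hf).hasProjectiveDimensionLT_X₃_iff n
    (ModuleCat.projective_of_categoryTheory_projective _)

lemma hasProjectiveDimensionLE_of_submodule (P : Submodule R M)
    (hP : HasProjectiveDimensionLE (ModuleCat.of R P) n)
    (hQ : HasProjectiveDimensionLE (ModuleCat.of R (M ⧸ P)) n) :
    HasProjectiveDimensionLE (ModuleCat.of R M) n :=
  hasProjectiveDimensionLE_of_ker_of_surjective P.mkQ_surjective (by rwa [P.ker_mkQ]) hQ

end Surjective

lemma exact_dfinsupp_mapRange {ι : Type*} {A B C : ι → Type*} [∀ i, AddCommGroup (A i)]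
    [∀ i, AddCommGroup (B i)] [∀ i, AddCommGroup (C i)] [∀ i, Module R (A i)]
    [∀ i, Module R (B i)] [∀ i, Module R (C i)] {f : ∀ i, A i →ₗ[R] B i} {g : ∀ i, B i →ₗ[R] C i}
    (h : ∀ i, Function.Exact (f i) (g i)) :
    Function.Exact (DFinsupp.mapRange.linearMap f) (DFinsupp.mapRange.linearMap g) := by
  rw [LinearMap.exact_iff, DFinsupp.ker_mapRangeLinearMap, DFinsupp.range_mapRangeLinearMap]
  simp only [fun i => (h i).linearMap_ker_eq]

lemma hasProjectiveDimensionLE_dfinsupp {ι : Type u} {n : ℕ} (M : ι → Type u)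
    [∀ i, AddCommGroup (M i)] [∀ i, Module R (M i)]
    (h : ∀ i, HasProjectiveDimensionLE (ModuleCat.of R (M i)) n) :
    HasProjectiveDimensionLE (ModuleCat.of R (Π₀ i, M i)) n := by
  classical
  induction n generalizing M with
  | zero =>
    have (i : ι) : Module.Projective R (M i) :=
      (IsProjective.iff_projective _).mpr (projective_iff_hasProjectiveDimensionLT_one.mpr (h i))
    have : Module.Projective R (Π₀ i, M i) := inferInstanceAs (Module.Projective R (DirectSum ι M))
    exact hasProjectiveDimensionLE_of_projective _ _
  | succ n ih =>
    let g (i : ι) : (M i →₀ R) →ₗ[R] M i := Finsupp.linearCombination R id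
    have hg (i : ι) : Function.Surjective (g i) := Finsupp.linearCombination_id_surjective R (M i)
    have hexact := exact_dfinsupp_mapRange fun i => (g i).exact_subtype_ker_map
    have hproj : Module.Projective R (Π₀ i, M i →₀ R) :=
      inferInstanceAs (Module.Projective R (DirectSum ι fun i => M i →₀ R))
    have hS := ModuleCat.shortComplex_shortExact
      (ModuleCat.shortComplexOfCompEqZero _ _ hexact.linearMap_comp_eq_zero) hexact
      ((DFinsupp.mapRange_injective _ fun _ => rfl).mpr fun _ => Subtype.val_injective)
      ((DFinsupp.mapRange_surjective _ fun i => (g i).map_zero).mpr hg)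
    exact hS.hasProjectiveDimensionLT_X₃ _
      (ih _ fun i => (hasProjectiveDimensionLE_succ_iff_ker (hg i)).mp (h i))
      (hasProjectiveDimensionLE_of_projective _ _)

end ProjectiveDimension

section Idempotent

variable {R : Type u} [Ring R]

lemma exists_isIdempotentElem_mul_mem_jacobson [IsSemiprimaryRing R] {m : Ideal R}
    (hm : Ring.jacobson R ≤ m) {e : R} (he : IsIdempotentElem e) (hem : 1 - e ∈ m) :
    ∃ c : R, IsIdempotentElem c ∧ e * c = c ∧ c * e = c ∧ 1 - c ∈ m ∧
      ∀ x ∈ m, x * c ∈ Ring.jacobson R := by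
  let q := Ideal.Quotient.mk (Ring.jacobson R)
  have hq : Function.Surjective q := Ideal.Quotient.mk_surjective
  have hker : RingHom.ker q = Ring.jacobson R := Ideal.mk_ker
  obtain ⟨f, hf, hmf⟩ := IsSemisimpleRing.ideal_eq_span_idempotent (m.map q)
  have mem_iff (x : R) : x ∈ m ↔ q x * (1 - f) = 0 := by
    have : x ∈ m ↔ q x ∈ Ideal.span {f} := by
      rw [← hmf, ← Ideal.mem_comap, Ideal.comap_map_of_surjective' q hq, hker, sup_eq_left.mpr hm]
    rw [this, Ideal.mem_span_singleton', mul_sub, mul_one, sub_eq_zero]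
    exact ⟨fun ⟨a, ha⟩ => by rw [← ha, mul_assoc, hf.eq], fun h => ⟨q x, h.symm⟩⟩
  have hef : q e * (1 - f) = 1 - f := by
    symm
    simpa [sub_mul, sub_eq_zero] using (mem_iff _).mp hem
  have hqe : q e * q e = q e := he.map q
  have hnil : ∀ x ∈ RingHom.ker q, IsNilpotent x := fun x hx => by
    obtain ⟨n, hn⟩ := IsSemiprimaryRing.isNilpotent (R := R)
    rw [hker] at hx
    exact ⟨n, by simpa [hn] using Ideal.pow_mem_pow hx n⟩
  obtain ⟨c, hc, hqc, hce, hec⟩ := exists_isIdempotentElem_mul_eq_zero_of_ker_isNilpotent q hnil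
    ((1 - f) * q e) (hq _)
    (by rw [IsIdempotentElem, mul_assoc, ← mul_assoc (q e), hef, ← mul_assoc, hf.one_sub.eq])
    (1 - e) he.one_sub (by simp [mul_assoc, mul_sub, hqe])
    (by rw [map_sub, map_one, sub_mul, one_mul, ← mul_assoc, hef, sub_self])
  refine ⟨c, hc, ?_, ?_, ?_, fun x hx => ?_⟩
  · simpa [sub_mul, sub_eq_zero, eq_comm] using hec
  · simpa [mul_sub, sub_eq_zero, eq_comm] using hce
  · rw [mem_iff, map_sub, map_one, hqc, sub_mul, one_mul, mul_assoc, hef, hf.one_sub.eq, sub_self]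
  · rw [← hker, RingHom.mem_ker, map_mul, hqc, ← mul_assoc, (mem_iff x).mp hx, zero_mul]

lemma projective_span_singleton_mul {p c : R} [Module.Projective R (Ideal.span {p})]
    (hc : IsIdempotentElem c) (hpc : p * c ∈ Ideal.span {p}) :
    Module.Projective R (Ideal.span {p * c}) := by
  have mul_mem (x : R) (hx : x ∈ Ideal.span {p}) : x * c ∈ Ideal.span {p * c} := by
    obtain ⟨a, rfl⟩ := Ideal.mem_span_singleton'.mp hx
    exact Ideal.mem_span_singleton'.mpr ⟨a, (mul_assoc a p c).symm⟩
  refine .of_split (Submodule.inclusion (Ideal.span_le.mpr (Set.singleton_subset_iff.mpr hpc)))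
    ((LinearMap.toSpanSingleton R R c).restrict mul_mem) ?_
  ext ⟨x, hx⟩
  obtain ⟨a, rfl⟩ := Ideal.mem_span_singleton'.mp hx
  change a * (p * c) * c = a * (p * c)
  rw [mul_assoc, mul_assoc, hc.eq]

lemma projective_span_singleton_of_isIdempotentElem {c : R} (hc : IsIdempotentElem c) :
    Module.Projective R (Ideal.span {c}) := by
  have : Module.Projective R (Ideal.span {(1 : R)}) :=
    .of_equiv ((LinearEquiv.ofTop _ Ideal.span_singleton_one).symm)
  exact one_mul c ▸ projective_span_singleton_mul (p := 1) hc (by simp)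

lemma projective_span_singleton_of_coe {M : Type*} [AddCommGroup M] [Module R M]
    {P : Submodule R M} (x : P) [Module.Projective R (R ∙ (x : M))] :
    Module.Projective R (R ∙ x) := by
  have hmap : (R ∙ x).map P.subtype = R ∙ (x : M) := by
    rw [Submodule.map_span, Set.image_singleton, P.subtype_apply]
  exact .of_equiv (((R ∙ x).equivMapOfInjective P.subtype P.subtype_injective).trans
    (LinearEquiv.ofEq _ _ hmap)).symm

lemma projective_span_singleton_of_epi {p e : R} (he : IsIdempotentElem e) (hep : e * p = p)
    (hepi : ∀ g : R, g * p = 0 → g * e = 0) : Module.Projective R (Ideal.span {p}) := by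
  have := projective_span_singleton_of_isIdempotentElem he
  let f := (LinearMap.toSpanSingleton R R p).domRestrict (Ideal.span {e})
  have hf : Function.Injective f := by
    rw [injective_iff_map_eq_zero]
    rintro ⟨x, hx⟩ hfx
    obtain ⟨a, rfl⟩ := Ideal.mem_span_singleton'.mp hx
    simpa [mul_assoc, he.eq] using hepi _ hfx
  have hrange : LinearMap.range f = Ideal.span {p} := by
    rw [LinearMap.range_domRestrict, Ideal.span, LinearMap.map_span, Set.image_singleton,
      LinearMap.toSpanSingleton_apply, smul_eq_mul, hep]
  exact .of_equiv ((LinearEquiv.ofInjective f hf).trans (LinearEquiv.ofEq _ _ hrange))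

end Idempotent

/-- Idempotents `e 0, …, e (n - 1)` of a ring adding up to `1`, extended by zero, together with
elements `p t` that play the role of epimorphisms from the object of `e t` to that of `e (t + 1)`
(composition being multiplication). Endomorphisms of layer `t` descend along `p t`, and radical
morphisms from layer `t` to later layers factor through `p t`. -/
structure IdempotentLayering (R : Type u) [Ring R] (n : ℕ) where
  e : ℕ → R
  p : ℕ → R
  isIdempotentElem (t : ℕ) : IsIdempotentElem (e t)
  eq_zero (t : ℕ) : n ≤ t → e t = 0
  sum_eq_one : ∑ t ∈ Finset.range n, e t = 1
  e_mul_p (t : ℕ) : e (t + 1) * p t = p t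
  p_epi (t : ℕ) (g : R) : g * p t = 0 → g * e (t + 1) = 0
  exists_p_mul (t : ℕ) (c : R) : e t * c = c → c * e t = c → ∃ d, p t * c = d * p t
  exists_eq_mul_p (t j : ℕ) (f : R) : t ≤ j → e j * f = f → f * e t = f →
    f ∈ Ring.jacobson R → ∃ g, f = g * p t

namespace IdempotentLayering

variable {R : Type u} [Ring R] {n : ℕ} (E : IdempotentLayering R n)

/-- The modules without composition factors in the layers from `t` on. -/
def VanishesFrom (t : ℕ) (M : Type*) [AddCommGroup M] [Module R M] : Prop :=
  ∀ j, t ≤ j → E.e j ∈ Module.annihilator R M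

section VanishesFrom

variable {E} {t : ℕ} {M N : Type*} [AddCommGroup M] [Module R M] [AddCommGroup N] [Module R N]

lemma VanishesFrom.of_injective (h : E.VanishesFrom t M) (f : N →ₗ[R] M)
    (hf : Function.Injective f) : E.VanishesFrom t N :=
  fun j hj => f.annihilator_le_of_injective hf (h j hj)

lemma VanishesFrom.of_surjective (h : E.VanishesFrom t M) (f : M →ₗ[R] N)
    (hf : Function.Surjective f) : E.VanishesFrom t N :=
  fun j hj => f.annihilator_le_of_surjective hf (h j hj)

lemma VanishesFrom.subsingleton (h : E.VanishesFrom 0 M) : Subsingleton M := by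
  rw [← Module.annihilator_eq_top_iff (R := R), Ideal.eq_top_iff_one, ← E.sum_eq_one]
  exact sum_mem fun j _ => h j j.zero_le

lemma VanishesFrom.of_succ (h : E.VanishesFrom (t + 1) M) (ht : E.e t ∈ Module.annihilator R M) :
    E.VanishesFrom t M := fun j hj => by
  rcases hj.eq_or_lt with rfl | hlt
  exacts [ht, h j hlt]

lemma vanishesFrom_length : E.VanishesFrom n M := fun j hj => by
  rw [E.eq_zero j hj]
  exact zero_mem _

end VanishesFrom

lemma projective_span_p_mul {t : ℕ} {c : R} (hc : IsIdempotentElem c) (hec : E.e t * c = c)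
    (hce : c * E.e t = c) : Module.Projective R (Ideal.span {E.p t * c}) := by
  have := projective_span_singleton_of_epi (E.isIdempotentElem (t + 1)) (E.e_mul_p t) (E.p_epi t)
  obtain ⟨d, hd⟩ := E.exists_p_mul t c hec hce
  exact projective_span_singleton_mul hc (hd ▸ Ideal.mem_span_singleton'.mpr ⟨d, rfl⟩)

lemma exists_e_mul_eq {t j : ℕ} (htj : t ≤ j) {c x : R} (hce : c * E.e t = c) (hxc : x * c = x)
    (hx : x ∈ Ring.jacobson R) : ∃ g, E.e j * x = g * (E.p t * c) := by
  obtain ⟨g, hg⟩ := E.exists_eq_mul_p t j (E.e j * x) htj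
    (by rw [← mul_assoc, (E.isIdempotentElem j).eq])
    (by rw [mul_assoc, ← hxc, mul_assoc, hce]) (Ideal.mul_mem_left _ _ hx)
  exact ⟨g, by rw [← mul_assoc, ← hg, mul_assoc, hxc]⟩

variable [IsSemiprimaryRing R]

lemma exists_cover_of_isSimpleModule {t : ℕ} (S : Type*) [AddCommGroup S] [Module R S]
    [IsSimpleModule R S] (hS : E.e t ∉ Module.annihilator R S) :
    ∃ (c : R) (s : S), IsIdempotentElem c ∧ E.e t * c = c ∧ c * E.e t = c ∧ s ≠ 0 ∧ c • s = s ∧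
      ∀ x, x • s = 0 → x * c ∈ Ring.jacobson R := by
  obtain ⟨s₀, hs₀⟩ : ∃ s : S, E.e t • s ≠ 0 := by simpa [Module.mem_annihilator] using hS
  let s := E.e t • s₀
  have hes : E.e t • s = s := by rw [← mul_smul, (E.isIdempotentElem t).eq]
  have := IsSimpleModule.ker_toSpanSingleton_isMaximal R hs₀
  obtain ⟨c, hc, hec, hce, hcm, hmc⟩ := exists_isIdempotentElem_mul_mem_jacobson
    (Ring.jacobson_le_of_isMaximal (LinearMap.ker (LinearMap.toSpanSingleton R S s)))
    (E.isIdempotentElem t) (by simp [sub_smul, hes])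
  exact ⟨c, s, hc, hec, hce, hs₀, Eq.symm (by simpa [sub_smul, sub_eq_zero] using hcm), hmc⟩

lemma hasProjectiveDimensionLE_of_isSimpleModule (t : ℕ)
    (ih : ∀ (M : Type u) [AddCommGroup M] [Module R M], E.VanishesFrom t M →
      HasProjectiveDimensionLE (ModuleCat.of R M) t)
    (S : Type u) [AddCommGroup S] [Module R S] [IsSimpleModule R S]
    (hS : E.VanishesFrom (t + 1) S) : HasProjectiveDimensionLE (ModuleCat.of R S) (t + 1) := by
  by_cases het : E.e t ∈ Module.annihilator R S
  · have := ih S (hS.of_succ het)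
    exact hasProjectiveDimensionLT_of_ge _ (t + 1) _ (by lia)
  obtain ⟨c, s, hc, hec, hce, hs, hcs, hsJ⟩ := E.exists_cover_of_isSimpleModule S het
  let φ : Ideal.span {c} →ₗ[R] S := (LinearMap.toSpanSingleton R S s).domRestrict _
  have hφ : Function.Surjective φ := fun y => by
    obtain ⟨r, rfl⟩ := IsSimpleModule.toSpanSingleton_surjective R hs y
    exact ⟨⟨r * c, Ideal.mem_span_singleton'.mpr ⟨r, rfl⟩⟩, by simp [φ, mul_smul, hcs]⟩
  have hpc : E.p t * c ∈ Ideal.span {c} := Ideal.mem_span_singleton'.mpr ⟨_, rfl⟩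
  let k₀ : LinearMap.ker φ := ⟨⟨E.p t * c, hpc⟩, by
    simpa [φ, ← mul_smul, mul_smul _ c, hcs, E.e_mul_p] using
      Module.mem_annihilator.mp (hS (t + 1) le_rfl) (E.p t • s)⟩
  have hproj : Module.Projective R (R ∙ k₀) := by
    have := E.projective_span_p_mul hc hec hce
    have : Module.Projective R (R ∙ (k₀ : Ideal.span {c})) :=
      projective_span_singleton_of_coe (k₀ : Ideal.span {c})
    exact projective_span_singleton_of_coe k₀
  have hvanish : E.VanishesFrom t (LinearMap.ker φ ⧸ R ∙ k₀) := fun j hj => by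
    rw [Module.mem_annihilator, (Submodule.mkQ_surjective _).forall]
    rintro ⟨⟨x, hxc⟩, hx⟩
    obtain ⟨a, rfl⟩ := Ideal.mem_span_singleton'.mp hxc
    have hac : a * c * c = a * c := by rw [mul_assoc, hc.eq]
    obtain ⟨g, hg⟩ := E.exists_e_mul_eq hj hce hac (hac ▸ hsJ _ (by simpa [φ] using hx))
    rw [← map_smul, Submodule.mkQ_apply, Submodule.Quotient.mk_eq_zero,
      Submodule.mem_span_singleton]
    exact ⟨g, by ext; exact hg.symm⟩
  have := projective_span_singleton_of_isIdempotentElem hc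
  exact (hasProjectiveDimensionLE_succ_iff_ker hφ).mpr (hasProjectiveDimensionLE_of_submodule _
    (hasProjectiveDimensionLE_of_projective _ t) (ih _ hvanish))

theorem hasProjectiveDimensionLE_of_vanishesFrom (t : ℕ) (M : Type u) [AddCommGroup M] [Module R M]
    (hM : E.VanishesFrom t M) : HasProjectiveDimensionLE (ModuleCat.of R M) t := by
  induction t generalizing M with
  | zero =>
    have := hM.subsingleton
    exact hasProjectiveDimensionLE_of_projective M 0
  | succ t ih =>
    revert hM
    refine IsSemiprimaryRing.induction R R M (P := fun M _ _ _ => E.VanishesFrom (t + 1) M →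
      HasProjectiveDimensionLE (ModuleCat.of R M) (t + 1)) ?_ ?_
    · intro M _ _ _ _ _ _ hM
      obtain ⟨s, e, hs⟩ := (isSemisimpleModule_iff_exists_linearEquiv_dfinsupp (R := R)).mp ‹_›
      have := hasProjectiveDimensionLE_dfinsupp (n := t + 1) (fun N : s => N.1) fun N =>
        have := hs N
        E.hasProjectiveDimensionLE_of_isSimpleModule t ih N.1
          (hM.of_injective _ N.1.subtype_injective)
      exact hasProjectiveDimensionLT_of_iso e.symm.toModuleIso _
    · intro M _ _ _ _ N hN hQ hM
      exact hasProjectiveDimensionLE_of_submodule N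
        (hN (hM.of_injective _ N.subtype_injective)) (hQ (hM.of_surjective _ N.mkQ_surjective))

include E in
theorem globalDimension_le : globalDimension R ≤ (n : ℕ∞) :=
  iSup_le fun M => (projectiveDimension_le_iff M n).mpr
    (E.hasProjectiveDimensionLE_of_vanishesFrom n M E.vanishesFrom_length)

end IdempotentLayering

lemma exists_eq_comp_of_ker_le {R M N P : Type*} [Ring R] [AddCommGroup M] [AddCommGroup N]
    [AddCommGroup P] [Module R M] [Module R N] [Module R P] {π : M →ₗ[R] N}
    (hπ : Function.Surjective π) (f : M →ₗ[R] P) (h : LinearMap.ker π ≤ LinearMap.ker f) :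
    ∃ g : N →ₗ[R] P, f = g ∘ₗ π :=
  ⟨(LinearMap.ker π).liftQ f h ∘ₗ (π.quotKerEquivOfSurjective hπ).symm, by
    ext x
    simp [LinearMap.quotKerEquivOfSurjective_symm_apply]⟩

lemma mem_ring_jacobson_iff {R : Type*} [Ring R] {x : R} :
    x ∈ Ring.jacobson R ↔ ∀ y, ∃ z, z * (1 + y * x) = 1 := by
  rw [← Ideal.jacobson_bot, Ideal.mem_jacobson_iff]
  refine forall_congr' fun y => exists_congr fun z => ?_
  rw [Submodule.mem_bot, sub_eq_zero, mul_add, mul_one, add_comm, mul_assoc]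

lemma mem_jacobson_end_of_retract {R M N : Type*} [Ring R] [AddCommGroup M] [AddCommGroup N]
    [Module R M] [Module R N] {i : M →ₗ[R] N} {r : N →ₗ[R] M} (hri : r ∘ₗ i = .id)
    {h : Module.End R M} (hh : (i ∘ₗ h ∘ₗ r : Module.End R N) ∈ Ring.jacobson (Module.End R N)) :
    h ∈ Ring.jacobson (Module.End R M) := by
  rw [mem_ring_jacobson_iff] at hh ⊢
  intro y
  obtain ⟨z, hz⟩ := hh (i ∘ₗ y ∘ₗ r)
  refine ⟨r ∘ₗ z ∘ₗ i, LinearMap.ext fun x => ?_⟩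
  have hri' (x : M) : r (i x) = x := LinearMap.congr_fun hri x
  simpa [hri'] using congrArg r (LinearMap.congr_fun hz (i x))

section EndSocle

variable (R M : Type*) [Ring R] [AddCommGroup M] [Module R M]

/-- The elements of a module killed by the Jacobson radical of its endomorphism ring. When that
ring is semiprimary, this is the socle of the module over its endomorphism ring. -/
def endSocle : Submodule R M :=
  ⨅ g ∈ Ring.jacobson (Module.End R M), LinearMap.ker g

variable {R M}

lemma mem_endSocle {x : M} :
    x ∈ endSocle R M ↔ ∀ g ∈ Ring.jacobson (Module.End R M), g x = 0 := by
  simp [endSocle]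

lemma map_mem_endSocle (f : Module.End R M) {x : M} (hx : x ∈ endSocle R M) :
    f x ∈ endSocle R M :=
  mem_endSocle.mpr fun g hg => mem_endSocle.mp hx (g * f) (Ideal.mul_mem_right f _ hg)

lemma eq_zero_of_forall_mem_jacobson_pow (hbot : endSocle R M = ⊥) (k : ℕ) {x : M}
    (hx : ∀ g ∈ Ring.jacobson (Module.End R M) ^ k, g x = 0) : x = 0 := by
  induction k generalizing x with
  | zero => exact hx 1 (by simp only [Submodule.pow_zero, Ideal.one_eq_top, Submodule.mem_top])
  | succ k ih =>
    rw [← Submodule.mem_bot R, ← hbot, mem_endSocle]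
    refine fun g hg => ih fun h hh => hx (h * g) ?_
    rw [Submodule.pow_succ]
    exact Ideal.mul_mem_mul hh hg

lemma endSocle_ne_bot [Nontrivial M] (h : IsNilpotent (Ring.jacobson (Module.End R M))) :
    endSocle R M ≠ ⊥ := fun hbot => by
  obtain ⟨n, hn⟩ := h
  obtain ⟨x, hx⟩ := exists_ne (0 : M)
  refine hx (eq_zero_of_forall_mem_jacobson_pow hbot n fun g hg => ?_)
  rw [hn, Ideal.zero_eq_bot, Ideal.mem_bot] at hg
  rw [hg, LinearMap.zero_apply]

variable (R M)

/-- The kernels of the successive quotients `M = M₀ → M₁ → M₂ → ⋯`, where `M_{t+1}` is the quotient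
of `M_t` by `endSocle R M_t`. -/
noncomputable def endSocleSeries : ℕ → Submodule R M
  | 0 => ⊥
  | t + 1 => (endSocle R (M ⧸ endSocleSeries t)).comap (endSocleSeries t).mkQ

/-- The module `M_t` in the tower `M = M₀ → M₁ → M₂ → ⋯` of `endSocleSeries`. -/
abbrev EndSocleQuotient (t : ℕ) : Type _ := M ⧸ endSocleSeries R M t

lemma endSocleSeries_le_succ (t : ℕ) : endSocleSeries R M t ≤ endSocleSeries R M (t + 1) := by
  rw [endSocleSeries]
  exact (endSocleSeries R M t).le_comap_mkQ _

/-- The projection `M_t → M_{t+1}` in the tower of `endSocleSeries`. -/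
noncomputable def endSocleProj (t : ℕ) :
    EndSocleQuotient R M t →ₗ[R] EndSocleQuotient R M (t + 1) :=
  Submodule.factor (endSocleSeries_le_succ R M t)

lemma endSocleProj_surjective (t : ℕ) : Function.Surjective (endSocleProj R M t) :=
  Submodule.factor_surjective (endSocleSeries_le_succ R M t)

lemma ker_endSocleProj (t : ℕ) :
    LinearMap.ker (endSocleProj R M t) = endSocle R (EndSocleQuotient R M t) := by
  ext x
  obtain ⟨y, rfl⟩ := Submodule.mkQ_surjective _ x
  exact Submodule.Quotient.mk_eq_zero (endSocleSeries R M (t + 1))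

lemma exists_endSocleSeries_eq_top [IsNoetherian R M]
    (h : ∀ t, IsNilpotent (Ring.jacobson (Module.End R (EndSocleQuotient R M t)))) :
    ∃ n, ∀ t, n ≤ t → endSocleSeries R M t = ⊤ := by
  obtain ⟨n, hn⟩ := monotone_stabilizes_iff_noetherian.mpr ‹_›
    ⟨endSocleSeries R M, monotone_nat_of_le_succ (endSocleSeries_le_succ R M)⟩
  suffices endSocleSeries R M n = ⊤ from ⟨n, fun t ht => (hn t ht).symm.trans this⟩
  by_contra htop
  have : Nontrivial (EndSocleQuotient R M n) := Submodule.Quotient.nontrivial_iff.mpr htop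
  refine endSocle_ne_bot (h n) ?_
  rw [← ker_endSocleProj, LinearMap.ker_eq_bot', (Submodule.mkQ_surjective _).forall]
  intro y hy
  have hn' : endSocleSeries R M n = endSocleSeries R M (n + 1) := hn (n + 1) n.le_succ
  exact (Submodule.Quotient.mk_eq_zero _).mpr (hn' ▸ (Submodule.Quotient.mk_eq_zero _).mp hy)

variable {R M}

lemma exists_endSocleProj_comp (t : ℕ) (c : Module.End R (EndSocleQuotient R M t)) :
    ∃ d : Module.End R (EndSocleQuotient R M (t + 1)),
      endSocleProj R M t ∘ₗ c = d ∘ₗ endSocleProj R M t :=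
  exists_eq_comp_of_ker_le (endSocleProj_surjective R M t) _ fun x hx => by
    rw [ker_endSocleProj] at hx
    rw [LinearMap.mem_ker, LinearMap.comp_apply, ← LinearMap.mem_ker, ker_endSocleProj]
    exact map_mem_endSocle c hx

-- A nonzero element of `M_{j+1}` lifts to one of `M_j` outside `endSocle R M_j`, hence not killed
-- by some radical endomorphism of `M_j`; the latter factors through `M_{j+1}`.
lemma exists_endSocleQuotient_map_ne_zero {t j : ℕ} (htj : t ≤ j) {x : EndSocleQuotient R M j}
    (hx : x ≠ 0) : ∃ u : EndSocleQuotient R M j →ₗ[R] EndSocleQuotient R M t, u x ≠ 0 := by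
  induction j, htj using Nat.le_induction with
  | base => exact ⟨.id, hx⟩
  | succ j _ ih =>
    obtain ⟨y, rfl⟩ := endSocleProj_surjective R M j x
    have hy : y ∉ endSocle R (EndSocleQuotient R M j) := by
      rwa [← ker_endSocleProj, LinearMap.mem_ker]
    obtain ⟨g, hg, hgy⟩ : ∃ g ∈ Ring.jacobson (Module.End R (EndSocleQuotient R M j)), g y ≠ 0 := by
      simpa [mem_endSocle] using hy
    obtain ⟨g', rfl⟩ := exists_eq_comp_of_ker_le (endSocleProj_surjective R M j) g fun z hz =>
      mem_endSocle.mp (ker_endSocleProj R M j ▸ hz) g hg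
    obtain ⟨u, hu⟩ := ih hgy
    exact ⟨u ∘ₗ g', hu⟩

lemma exists_eq_comp_endSocleProj {t j : ℕ} (htj : t ≤ j)
    (f : EndSocleQuotient R M t →ₗ[R] EndSocleQuotient R M j)
    (hf : ∀ u : EndSocleQuotient R M j →ₗ[R] EndSocleQuotient R M t,
      u ∘ₗ f ∈ Ring.jacobson (Module.End R (EndSocleQuotient R M t))) :
    ∃ g, f = g ∘ₗ endSocleProj R M t :=
  exists_eq_comp_of_ker_le (endSocleProj_surjective R M t) f fun x hx => by
    rw [ker_endSocleProj] at hx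
    by_contra hfx
    obtain ⟨u, hu⟩ := exists_endSocleQuotient_map_ne_zero htj hfx
    exact hu (mem_endSocle.mp hx _ (hf u))

/-- The layering of the endomorphism ring of a module having the modules `M_t` of the tower of
`endSocleSeries` as retracts. -/
noncomputable def endSocleLayering {Y : Type*} [AddCommGroup Y] [Module R Y] {n : ℕ}
    (i : ∀ t, EndSocleQuotient R M t →ₗ[R] Y) (r : ∀ t, Y →ₗ[R] EndSocleQuotient R M t)
    (hri : ∀ t, r t ∘ₗ i t = .id) (hzero : ∀ t, n ≤ t → i t = 0)
    (hsum : ∑ t ∈ Finset.range n, i t ∘ₗ r t = .id) :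
    IdempotentLayering (Module.End R Y) n :=
  have hri' (t : ℕ) (x : EndSocleQuotient R M t) : r t (i t x) = x := LinearMap.congr_fun (hri t) x
  { e t := i t ∘ₗ r t
    p t := i (t + 1) ∘ₗ endSocleProj R M t ∘ₗ r t
    isIdempotentElem t := LinearMap.ext fun x => by simp [hri']
    eq_zero t ht := by rw [hzero t ht, LinearMap.zero_comp]
    sum_eq_one := hsum
    e_mul_p t := LinearMap.ext fun x => by simp [hri']
    p_epi t g h := LinearMap.ext fun y => by
      obtain ⟨z, hz⟩ := endSocleProj_surjective R M t (r (t + 1) y)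
      simpa [hri', hz] using LinearMap.congr_fun h (i t z)
    exists_p_mul t c _ hce := by
      obtain ⟨d, hd⟩ := exists_endSocleProj_comp t (r t ∘ₗ c ∘ₗ i t)
      refine ⟨i (t + 1) ∘ₗ d ∘ₗ r (t + 1), LinearMap.ext fun y => ?_⟩
      have hdy := LinearMap.congr_fun hd (r t y)
      have hcy : c (i t (r t y)) = c y := LinearMap.congr_fun hce y
      simp only [LinearMap.comp_apply, hcy] at hdy
      simp only [Module.End.mul_apply, LinearMap.comp_apply, hri', hdy]
    exists_eq_mul_p t j f htj hef hfe hf := by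
      obtain ⟨g, hg⟩ := exists_eq_comp_endSocleProj htj (r j ∘ₗ f ∘ₗ i t) fun u =>
        mem_jacobson_end_of_retract (hri t) (by
          have : (i t ∘ₗ (u ∘ₗ r j ∘ₗ f ∘ₗ i t) ∘ₗ r t : Module.End R Y) = (i t ∘ₗ u ∘ₗ r j) * f :=
            congrArg ((i t ∘ₗ u ∘ₗ r j) * ·) hfe
          rw [this]
          exact Ideal.mul_mem_left _ _ hf)
      refine ⟨i j ∘ₗ g ∘ₗ r (t + 1), LinearMap.ext fun y => ?_⟩
      have hgy := LinearMap.congr_fun hg (r t y)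
      have hfy : f (i t (r t y)) = f y := LinearMap.congr_fun hfe y
      have hefy : i j (r j (f y)) = f y := LinearMap.congr_fun hef y
      simp only [LinearMap.comp_apply, hfy] at hgy
      simp only [Module.End.mul_apply, LinearMap.comp_apply, hri', ← hgy, hefy] }

end EndSocle

lemma exists_retracts_of_linearEquiv_pi {R : Type*} [Ring R] {M : ℕ → Type*}
    [∀ t, AddCommGroup (M t)] [∀ t, Module R (M t)] {n : ℕ} (hM : ∀ t, n ≤ t → Subsingleton (M t))
    {Y : Type*} [AddCommGroup Y] [Module R Y] (φ : (∀ t : Fin n, M t) ≃ₗ[R] Y) :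
    ∃ (i : ∀ t, M t →ₗ[R] Y) (r : ∀ t, Y →ₗ[R] M t), (∀ t, r t ∘ₗ i t = .id) ∧
      (∀ t, n ≤ t → i t = 0) ∧ ∑ t ∈ Finset.range n, i t ∘ₗ r t = .id := by
  let i (t : ℕ) : M t →ₗ[R] Y :=
    if ht : t < n then φ ∘ₗ .single R (fun t : Fin n => M t) ⟨t, ht⟩ else 0
  let r (t : ℕ) : Y →ₗ[R] M t :=
    if ht : t < n then .proj (φ := fun t : Fin n => M t) ⟨t, ht⟩ ∘ₗ φ.symm else 0
  refine ⟨i, r, fun t => ?_, fun t ht => by simp [i, ht], ?_⟩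
  · by_cases ht : t < n
    · ext x
      simp only [i, r, ht, dif_pos, LinearMap.comp_apply, LinearEquiv.coe_coe,
        LinearEquiv.symm_apply_apply]
      exact Pi.single_eq_same (M := fun t : Fin n => M t) ⟨t, ht⟩ x
    · have := hM t (not_lt.mp ht)
      exact LinearMap.ext fun x => Subsingleton.elim _ _
  · have (t : Fin n) (y : Y) : i t (r t y) = φ (Pi.single t (φ.symm y t)) := by
      simp only [i, r, t.2, dif_pos]
      rfl
    rw [Finset.sum_range]
    ext y
    simp [this, ← map_sum, Finset.univ_sum_single]

theorem exists_globalDimension_end_prod_lt_top {R : Type u} [Ring R]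
    (h : ∀ (M : Type v) [AddCommGroup M] [Module R M] [Module.Finite R M],
      IsSemiprimaryRing (Module.End R M))
    (X : Type v) [AddCommGroup X] [Module R X] [IsNoetherian R X] :
    ∃ (X' : Type v) (_ : AddCommGroup X') (_ : Module R X'),
      Module.Finite R X' ∧ globalDimension (Module.End R (X × X')) < ⊤ := by
  obtain ⟨n, hn⟩ := exists_endSocleSeries_eq_top R X fun t =>
    (h (EndSocleQuotient R X t)).isNilpotent
  let X' := ∀ t : Fin n, EndSocleQuotient R X (t + 1)
  let φ : (∀ t : Fin (n + 1), EndSocleQuotient R X t) ≃ₗ[R] X × X' :=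
    (Fin.consLinearEquiv R fun t : Fin (n + 1) => EndSocleQuotient R X t).symm ≪≫ₗ
      (Submodule.quotEquivOfEqBot _ rfl).prodCongr (.refl R X')
  obtain ⟨i, r, hri, hzero, hsum⟩ := exists_retracts_of_linearEquiv_pi
    (fun t ht => Submodule.Quotient.subsingleton_iff.mpr (hn t (by lia))) φ
  have := h (X × X')
  refine ⟨X', inferInstance, inferInstance, inferInstance, ?_⟩
  exact (endSocleLayering i r hri hzero hsum).globalDimension_le.trans_lt
    (WithBot.coe_lt_coe.mpr (ENat.natCast_lt_top _))

section EssentialSubmodule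

/-- A submodule is essential if it has nonzero intersection with every nonzero submodule. -/
def IsEssentialSubmodule {R M : Type*} [Ring R] [AddCommGroup M] [Module R M]
    (S : Submodule R M) : Prop :=
  ∀ P, Disjoint P S → P = ⊥

lemma exists_disjoint_isEssentialSubmodule_map_mkQ {R M : Type*} [Ring R] [AddCommGroup M]
    [Module R M] (S : Submodule R M) :
    ∃ C : Submodule R M, Disjoint C S ∧ IsEssentialSubmodule (S.map C.mkQ) := by
  obtain ⟨C, -, hC⟩ := zorn_le_nonempty₀ {C : Submodule R M | Disjoint C S}
    (fun c hc hchain _ _ => ⟨sSup c, hchain.directedOn.disjoint_sSup_left.mpr hc,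
      fun _ => le_sSup⟩) ⊥ disjoint_bot_left
  refine ⟨C, hC.prop, fun P hP => ?_⟩
  have hcomap : Disjoint (P.comap C.mkQ) S := by
    rw [Submodule.disjoint_def] at hP ⊢
    intro x hxP hxS
    have hxC : x ∈ C := by simpa using hP _ hxP (Submodule.mem_map_of_mem hxS)
    exact Submodule.disjoint_def.mp hC.prop x hxC hxS
  rw [← Submodule.map_comap_eq_of_surjective C.mkQ_surjective P, ← LinearMap.le_ker_iff_map,
    C.ker_mkQ]
  exact hC.le_of_ge hcomap (C.le_comap_mkQ P)

lemma IsEssentialSubmodule.le_of_isSemisimpleModule {R M : Type*} [Ring R] [AddCommGroup M]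
    [Module R M] {S N : Submodule R M} [IsSemisimpleModule R N] (hS : IsEssentialSubmodule S) :
    N ≤ S := by
  obtain ⟨W, hW⟩ := exists_isCompl (S.submoduleOf N)
  have hW0 : W.map N.subtype = ⊥ := hS _ <| Submodule.disjoint_def.mpr <| by
    rintro _ ⟨x, hx, rfl⟩ hxS
    exact congrArg N.subtype (Submodule.disjoint_def.mp hW.disjoint x hxS hx)
  rw [← LinearMap.le_ker_iff_map, N.ker_subtype, le_bot_iff] at hW0
  rw [← Submodule.submoduleOf_eq_top, ← hW.sup_eq_top, hW0, sup_bot_eq]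

lemma isNoetherian_torsionBySet_pow {R M : Type*} [CommRing R] [AddCommGroup M] [Module R M]
    {I : Ideal R} (hI : I.FG) [IsNoetherian R (Submodule.torsionBySet R M (I : Set R))] (n : ℕ) :
    IsNoetherian R (Submodule.torsionBySet R M (I ^ n : Ideal R)) := by
  induction n with
  | zero =>
    have : Submodule.torsionBySet R M ((I ^ 0 : Ideal R) : Set R) = ⊥ := by simp
    rw [this]
    infer_instance
  | succ n ih =>
    obtain ⟨s, hs⟩ := hI
    have hsI (a : s) : (a : R) ∈ I := hs ▸ Submodule.subset_span a.2
    let F := Submodule.torsionBySet R M ((I ^ (n + 1) : Ideal R) : Set R)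
    let f : F →ₗ[R] s → Submodule.torsionBySet R M ((I ^ n : Ideal R) : Set R) :=
      LinearMap.pi fun a => (LinearMap.lsmul R M a).restrict fun x hx => by
        rw [Submodule.mem_torsionBySet_iff] at hx ⊢
        intro b
        have := hx ⟨b * a, pow_succ I n ▸ Ideal.mul_mem_mul b.2 (hsI a)⟩
        rwa [mul_smul] at this
    have hker : (LinearMap.ker f).map F.subtype ≤ Submodule.torsionBySet R M (I : Set R) := by
      have hspan : Submodule.torsionBySet R M (s : Set R) = Submodule.torsionBySet R M I :=
        hs ▸ Submodule.torsionBySet_eq_torsionBySet_span _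
      rw [← hspan]
      rintro _ ⟨x, hx, rfl⟩
      rw [Submodule.mem_torsionBySet_iff]
      exact fun a => congrArg Subtype.val (congrFun (LinearMap.mem_ker.mp hx) a)
    have := isNoetherian_of_le hker
    have : IsNoetherian R (LinearMap.ker f) := isNoetherian_of_linearEquiv
      ((LinearMap.ker f).equivMapOfInjective F.subtype F.subtype_injective).symm
    exact isNoetherian_of_range_eq_ker (LinearMap.ker f).subtype f (by simp)

lemma IsEssentialSubmodule.isNoetherian_of_isArtinianRing {R M : Type*} [CommRing R]
    [IsArtinianRing R] [AddCommGroup M] [Module R M] {S : Submodule R M} [IsNoetherian R S]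
    (hS : IsEssentialSubmodule S) : IsNoetherian R M := by
  let N := Submodule.torsionBySet R M (Ring.jacobson R : Set R)
  have : IsSemisimpleModule R N := (Submodule.torsionBySet_isTorsionBySet
    (Ring.jacobson R : Set R)).isSemisimpleModule_iff.mp inferInstance
  have : IsNoetherian R N := isNoetherian_of_le hS.le_of_isSemisimpleModule
  obtain ⟨n, hn⟩ := IsSemiprimaryRing.isNilpotent (R := R)
  have hnoeth := isNoetherian_torsionBySet_pow (M := M) (Ring.jacobson R).fg_of_isNoetherianRing n
  have htop : Submodule.torsionBySet R M ((Ring.jacobson R ^ n : Ideal R) : Set R) = ⊤ := by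
    ext x
    simp [hn]
  rw [htop] at hnoeth
  exact isNoetherian_top_iff.mp hnoeth

end EssentialSubmodule

section Cogenerator

lemma exists_linearMap_pi_quotient_maximalSpectrum_ne_zero {R M : Type*} [CommRing R]
    [AddCommGroup M] [Module R M] {x : M} (hx : x ≠ 0) :
    ∃ f : (R ∙ x) →ₗ[R] ∀ m : MaximalSpectrum R, R ⧸ m.asIdeal,
      f ⟨x, Submodule.mem_span_singleton_self x⟩ ≠ 0 := by
  classical
  obtain ⟨m, hm, hle⟩ := Ideal.exists_le_maximal (Ideal.torsionOf R M x)
    ((Ideal.torsionOf_eq_top_iff R x).not.mpr hx)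
  let e := Ideal.quotTorsionOfEquivSpanSingleton R M x
  have he : e (Submodule.Quotient.mk 1) = ⟨x, Submodule.mem_span_singleton_self x⟩ :=
    Subtype.ext (one_smul R x)
  refine ⟨LinearMap.single R (fun m : MaximalSpectrum R => R ⧸ m.asIdeal) ⟨m, hm⟩ ∘ₗ
    Submodule.factor hle ∘ₗ e.symm, ?_⟩
  rw [← he]
  simp only [LinearMap.comp_apply, LinearEquiv.coe_coe, LinearEquiv.symm_apply_apply]
  rw [LinearMap.single_apply, Ne, Pi.single_eq_zero_iff]
  exact Ideal.Quotient.eq_zero_iff_mem.not.mpr ((Ideal.ne_top_iff_one m).mp hm.ne_top)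

theorem exists_finite_module_separating_points (R : Type u) [CommRing R] [IsArtinianRing R] :
    ∃ (E : Type u) (_ : AddCommGroup E) (_ : Module R E), Module.Finite R E ∧
      ∀ (M : Type v) [AddCommGroup M] [Module R M] (x : M), x ≠ 0 →
        ∃ f : M →ₗ[R] E, f x ≠ 0 := by
  let T := ∀ m : MaximalSpectrum R, R ⧸ m.asIdeal
  obtain ⟨I, _, i, _⟩ := (EnoughInjectives.presentation (ModuleCat.of R T)).some
  have hi : Function.Injective i.hom := (ModuleCat.mono_iff_injective i).mp ‹_›
  have : Module.Injective R I := (Module.injective_iff_injective_object R I).mpr ‹_›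
  obtain ⟨C, hC, hess⟩ := exists_disjoint_isEssentialSubmodule_map_mkQ (LinearMap.range i.hom)
  have := hess.isNoetherian_of_isArtinianRing
  refine ⟨I ⧸ C, inferInstance, inferInstance, inferInstance, fun M _ _ x hx => ?_⟩
  obtain ⟨f, hf⟩ := exists_linearMap_pi_quotient_maximalSpectrum_ne_zero (R := R) hx
  obtain ⟨g, hg⟩ := Module.Injective.extension_property R I _ _ (R ∙ x).subtype
    (Submodule.subtype_injective _) (i.hom ∘ₗ f)
  have hgx : g x = i.hom (f ⟨x, Submodule.mem_span_singleton_self x⟩) :=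
    LinearMap.congr_fun hg ⟨x, Submodule.mem_span_singleton_self x⟩
  refine ⟨C.mkQ ∘ₗ g, fun h => hf (hi ?_)⟩
  rw [LinearMap.comp_apply, ← LinearMap.mem_ker, C.ker_mkQ] at h
  rw [map_zero, ← hgx]
  exact Submodule.disjoint_def.mp hC _ h ⟨_, hgx.symm⟩

lemma exists_injective_pi_of_separating_points {R M E : Type*} [Ring R] [AddCommGroup M]
    [Module R M] [AddCommGroup E] [Module R E] [IsArtinian R M]
    (h : ∀ x : M, x ≠ 0 → ∃ f : M →ₗ[R] E, f x ≠ 0) :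
    ∃ (n : ℕ) (f : M →ₗ[R] (Fin n → E)), Function.Injective f := by
  obtain ⟨s, hs⟩ := Finset.exists_inf_le (fun f : M →ₗ[R] E => LinearMap.ker f)
  let g : M →ₗ[R] (Fin s.card → E) := LinearMap.pi fun j => (s.equivFin.symm j).1
  refine ⟨s.card, g, (injective_iff_map_eq_zero g).mpr fun x hx => ?_⟩
  by_contra hx0
  obtain ⟨f, hf⟩ := h x hx0
  refine hf (hs f (Submodule.mem_finsetInf.mpr fun f' hf' => ?_))
  simpa [g] using congrFun hx (s.equivFin ⟨f', hf'⟩)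

end Cogenerator

section Coinduced

variable (k Λ E : Type*) [CommRing k] [Ring Λ] [Algebra k Λ] [AddCommGroup E] [Module k E]

/-- The left `Λ`-module structure on `Hom_k(Λ, E)` coming from right multiplication on `Λ`: the
module coinduced from the `k`-module `E`. It is a reducible definition, not an instance, since
`Λ →ₗ[k] E` may carry other actions. -/
abbrev coinducedModule : Module Λ (Λ →ₗ[k] E) where
  smul a f := f ∘ₗ LinearMap.mulRight k a
  one_smul f := LinearMap.ext fun x => congrArg f (mul_one x)
  mul_smul a b f := LinearMap.ext fun x => congrArg f (mul_assoc x a b).symm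
  smul_zero _ := rfl
  smul_add _ _ _ := rfl
  add_smul a b f := LinearMap.ext fun x => (congrArg f (mul_add x a b)).trans (map_add f _ _)
  zero_smul f := LinearMap.ext fun x => (congrArg f (mul_zero x)).trans (map_zero f)

end Coinduced

section ArtinAlgebra

lemma isArtinianRing_center (k Λ : Type*) [CommRing k] [IsArtinianRing k] [Ring Λ] [Algebra k Λ]
    [Module.Finite k Λ] : IsArtinianRing (Subring.center Λ) := by
  have : IsArtinian k (Subalgebra.center k Λ) :=
    isArtinian_of_injective (Subalgebra.center k Λ).val.toLinearMap Subtype.val_injective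
  exact (isArtinian_of_tower k this : IsArtinianRing (Subalgebra.center k Λ))

lemma finite_over_center (k Λ : Type*) [CommRing k] [Ring Λ] [Algebra k Λ] [Module.Finite k Λ] :
    Module.Finite (Subring.center Λ) Λ :=
  Module.Finite.of_restrictScalars_finite k (Subalgebra.center k Λ) Λ

lemma isSemiprimaryRing_end (k : Type*) {Λ : Type*} [CommRing k] [IsArtinianRing k] [Ring Λ]
    [Algebra k Λ] [Module.Finite k Λ] (M : Type*) [AddCommGroup M] [Module Λ M]
    [Module.Finite Λ M] : IsSemiprimaryRing (Module.End Λ M) := by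
  let _ : Module k M := Module.compHom M (algebraMap k Λ)
  have : IsScalarTower k Λ M := .of_algebraMap_smul fun _ _ => rfl
  have : SMulCommClass Λ k M := SMulCommClass.symm _ _ _
  have : Module.Finite k M := .trans Λ M
  obtain ⟨n, f, hf⟩ := Module.Finite.exists_fin' Λ M
  let evalGenerators : Module.End Λ M →ₗ[k] (Fin n → M) :=
    LinearMap.pi fun i => LinearMap.applyₗ' k (f (Pi.single i 1))
  have hinj : Function.Injective evalGenerators := fun g h hgh => by
    rw [← LinearMap.cancel_right hf]
    ext i
    exact congrFun hgh i
  have : IsArtinian k (Module.End Λ M) := isArtinian_of_injective evalGenerators hinj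
  have : IsArtinianRing (Module.End Λ M) := isArtinian_of_tower k this
  infer_instance

theorem exists_finite_cogeneratesFGModules (k Λ : Type u) [CommRing k] [IsArtinianRing k]
    [Ring Λ] [Algebra k Λ] [Module.Finite k Λ] :
    ∃ (D : Type u) (_ : AddCommGroup D) (_ : Module Λ D), Module.Finite Λ D ∧
      CogeneratesFGModules Λ D := by
  obtain ⟨E, _, _, _, hE⟩ := exists_finite_module_separating_points k
  let _ := coinducedModule k Λ E
  have smul_apply (a x : Λ) (f : Λ →ₗ[k] E) : (a • f) x = f (x * a) := rfl
  have : IsScalarTower k Λ (Λ →ₗ[k] E) := ⟨fun c a f => by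
    ext x
    rw [smul_apply, LinearMap.smul_apply, smul_apply, mul_smul_comm, map_smul]⟩
  have : IsArtinianRing Λ := isArtinian_of_tower k inferInstance
  refine ⟨Λ →ₗ[k] E, inferInstance, inferInstance, .of_restrictScalars_finite k Λ _, ?_⟩
  intro M _ _ _
  refine exists_injective_pi_of_separating_points fun x hx => ?_
  let _ : Module k M := Module.compHom M (algebraMap k Λ)
  have : IsScalarTower k Λ M := .of_algebraMap_smul fun _ _ => rfl
  obtain ⟨f, hf⟩ := hE M x hx
  let F : M →ₗ[Λ] (Λ →ₗ[k] E) :=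
    { toFun m := f ∘ₗ (LinearMap.toSpanSingleton Λ M m).restrictScalars k
      map_add' m n := by ext a; simp
      map_smul' b m := by ext a; simp [smul_apply, mul_smul] }
  refine ⟨F, fun h => hf ?_⟩
  simpa [F] using LinearMap.congr_fun h 1

end ArtinAlgebra

lemma CogeneratesFGModules.of_injective {R : Type u} [Ring R] {X Y : Type u} [AddCommGroup X]
    [Module R X] [AddCommGroup Y] [Module R Y] (h : CogeneratesFGModules R X) (i : X →ₗ[R] Y)
    (hi : Function.Injective i) : CogeneratesFGModules R Y := fun M _ _ _ => by
  obtain ⟨n, f, hf⟩ := h M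
  exact ⟨n, i.compLeft (Fin n) ∘ₗ f, hi.comp_left.comp hf⟩

lemma GeneratesFGModules.of_surjective {R : Type u} [Ring R] {X : Type u} [AddCommGroup X]
    [Module R X] (f : X →ₗ[R] R) (hf : Function.Surjective f) : GeneratesFGModules R X :=
  fun M _ _ _ => by
    obtain ⟨n, g, hg⟩ := Module.Finite.exists_fin' R M
    exact ⟨n, g ∘ₗ f.compLeft (Fin n), hg.comp hf.comp_left⟩

theorem mainTheorem3 (k : Type w) (Λ : Type u) [CommRing k] [IsArtinianRing k]
    [Ring Λ] [Algebra k Λ] [Module.Finite k Λ] :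
    (∀ (X : Type v) [AddCommGroup X] [Module Λ X] [Module.Finite Λ X],
      ∃ (X' : Type v) (_ : AddCommGroup X') (_ : Module Λ X'),
        Module.Finite Λ X' ∧ globalDimension (Module.End Λ (X × X')) < ⊤) ∧
    representationDimension Λ < ⊤ := by
  have : IsNoetherianRing Λ := isNoetherian_of_tower k inferInstance
  refine ⟨fun X _ _ _ => exists_globalDimension_end_prod_lt_top
    (fun M _ _ _ => isSemiprimaryRing_end k (Λ := Λ) M) X, ?_⟩
  have := isArtinianRing_center k Λ
  have := finite_over_center k Λ
  obtain ⟨D, _, _, _, hD⟩ := exists_finite_cogeneratesFGModules (Subring.center Λ) Λ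
  obtain ⟨X', _, _, _, hX'⟩ := exists_globalDimension_end_prod_lt_top
    (fun M _ _ _ => isSemiprimaryRing_end k (Λ := Λ) M) (Λ × D)
  refine lt_of_le_of_lt (sInf_le ⟨(Λ × D) × X', inferInstance, inferInstance, inferInstance,
    ?_, ?_, rfl⟩) hX'
  · exact .of_surjective (.fst Λ Λ D ∘ₗ .fst Λ (Λ × D) X')
      (Prod.fst_surjective.comp Prod.fst_surjective)
  · exact hD.of_injective (.inl Λ (Λ × D) X' ∘ₗ .inr Λ Λ D)
      (LinearMap.inl_injective.comp LinearMap.inr_injective)
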